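/- Let $X$ be a proper subset of $\mathbb{C}$, fix $x_0\in\mathbb{C}$ with $x_0\notin X$, and let $\mathcal{Y}$ be the directed set of all finite subsets of $X$, ordered by inclusion. For $Y\in\mathcal{Y}$ let $F(Y)$ be the free group on $Y$ and let $\pi_1(\mathbb{C}\smallsetminus Y,x_0)$ be the fundamental group of $\mathbb{C}\smallsetminus Y$ with base point $x_0$. For $Y\subseteq Y'$ in $\mathcal{Y}$ let $\varphi_{Y,Y'}\colon F(Y')\to F(Y)$ be the homomorphism with $\varphi_{Y,Y'}(y')=y'$ for $y'\in Y$ and $\varphi_{Y,Y'}(y')=1$ for $y'\in Y'\smallsetminus Y$, and let $\psi_{Y,Y'}\colon \pi_1(\mathbb{C}\smallsetminus Y',x_0)\to\pi_1(\mathbb{C}\smallsetminus Y,x_0)$ be the homomorphism induced by the inclusion $\mathbb{C}\smallsetminus Y'\subseteq\mathbb{C}\smallsetminus Y$. Then the projective systems $\big((\pi_1(\mathbb{C}\smallsetminus Y,x_0))_{Y\in\mathcal{Y}},(\psi_{Y,Y'})_{Y\subseteq Y'}\big)$ and $\big((F(Y))_{Y\in\mathcal{Y}},(\varphi_{Y,Y'})_{Y\subseteq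 Y'}\big)$ are isomorphic, i.e., there exists a family $(\alpha_Y)_{Y\in\mathcal{Y}}$ of group isomorphisms $\alpha_Y\colon F(Y)\to\pi_1(\mathbb{C}\smallsetminus Y,x_0)$ such that $\psi_{Y,Y'}\circ\alpha_{Y'}=\alpha_Y\circ\varphi_{Y,Y'}$ for all $Y\subseteq Y'$ in $\mathcal{Y}$. -/

import Mathlib

/-- The directed set of all finite subsets of a set `X` of complex numbers. As a subtype of
`Set ℂ` it is ordered by inclusion. -/
abbrev FiniteSubsets (X : Set ℂ) : Type :=
  {Y : Set ℂ // Y ⊆ X ∧ Y.Finite}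

/-- The base point `x₀ ∉ X`, as a point of the complement of `Y`, for `Y ⊆ X`. -/
def basePoint {X : Set ℂ} {x₀ : ℂ} (hx₀ : x₀ ∉ X) (Y : FiniteSubsets X) : (Y.1ᶜ : Set ℂ) :=
  ⟨x₀, fun h => hx₀ (Y.2.1 h)⟩

/-- The fundamental group of the complement of `Y` in the complex plane, with base point `x₀`. -/
abbrev PiOne {X : Set ℂ} {x₀ : ℂ} (hx₀ : x₀ ∉ X) (Y : FiniteSubsets X) : Type :=
  FundamentalGroup (Y.1ᶜ : Set ℂ) (basePoint hx₀ Y)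

/-- For `Y ⊆ Y'`, the inclusion of the complement of `Y'` in the complement of `Y`. -/
def complInclusion {Y Y' : Set ℂ} (h : Y ⊆ Y') : C((Y'ᶜ : Set ℂ), (Yᶜ : Set ℂ)) where
  toFun := Set.inclusion (Set.compl_subset_compl.mpr h)
  continuous_toFun := continuous_inclusion _

/-- For `Y ⊆ Y'`, the homomorphism of fundamental groups induced by the inclusion
of the complement of `Y'` in the complement of `Y`. -/
noncomputable def psi {X : Set ℂ} {x₀ : ℂ} (hx₀ : x₀ ∉ X) {Y Y' : FiniteSubsets X}
    (h : Y ≤ Y') : PiOne hx₀ Y' →* PiOne hx₀ Y :=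
  FundamentalGroup.map (complInclusion h) (basePoint hx₀ Y')

open Classical in
/-- For `Y ⊆ Y'`, the homomorphism from the free group on `Y'` to the free group on `Y` that
sends every generator `y' ∈ Y` to itself and every generator `y' ∉ Y` to `1`. -/
noncomputable def phi {X : Set ℂ} {Y Y' : FiniteSubsets X} (_h : Y ≤ Y') :
    FreeGroup Y'.1 →* FreeGroup Y.1 :=
  FreeGroup.lift fun y' : Y'.1 =>
    if hy : (y' : ℂ) ∈ Y.1 then FreeGroup.of (⟨y', hy⟩ : Y.1) else 1

/- The following four facts say that `phi` and `psi` define projective systems of groups. -/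

theorem phi_refl {X : Set ℂ} (Y : FiniteSubsets X) : phi (le_refl Y) = MonoidHom.id _ := by
  ext y
  simp [phi]

theorem phi_comp {X : Set ℂ} {Y Y' Y'' : FiniteSubsets X} (h : Y ≤ Y') (h' : Y' ≤ Y'') :
    (phi h).comp (phi h') = phi (h.trans h') := by
  ext y
  by_cases h1 : (y : ℂ) ∈ Y'.1
  · by_cases h2 : (y : ℂ) ∈ Y.1 <;> simp [phi, h1, h2]
  · have h2 : (y : ℂ) ∉ Y.1 := fun h2 => h1 (h h2)
    simp [phi, h1, h2]

theorem psi_refl {X : Set ℂ} {x₀ : ℂ} (hx₀ : x₀ ∉ X) (Y : FiniteSubsets X) :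
    psi hx₀ (le_refl Y) = MonoidHom.id _ := by
  ext p
  induction p using Quotient.inductionOn with
  | _ p => rfl

theorem psi_comp {X : Set ℂ} {x₀ : ℂ} (hx₀ : x₀ ∉ X) {Y Y' Y'' : FiniteSubsets X}
    (h : Y ≤ Y') (h' : Y' ≤ Y'') :
    (psi hx₀ h).comp (psi hx₀ h') = psi hx₀ (h.trans h') := by
  ext p
  induction p using Quotient.inductionOn with
  | _ p => rfl

/-! For finite `Y`, cut the plane along a ray from each point of `Y`, leading away from `x₀` to
infinity. If the rays are disjoint, the slit plane is star-shaped about `x₀`, and gluing thin strips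
across the cuts gives a fundamental group that is free on loops crossing one cut each. Straight rays
overlap when two points are aligned with `x₀`. Twisting the plane around `x₀` by the angle `ε * ‖z -
x₀‖` makes them disjoint for all small `ε > 0` (`eventually_not_mem_sector`).

Freeness is proved for an abstract `CutDecomposition`. The crossing loops generate because any loop
can be followed with return paths to the base point that change only by crossing loops
(`closure_range_loop`). They are independent because some covering with fibre `FreeGroup J` has
monodromy given by left multiplication by the generators (`monodromyPerm_loop`).

The admissible `ε` depend on `Y`, but the loops vary continuously with `ε`, so their classes do not
depend on it (`Separated.mk_path_eq`). For `Y ⊆ Y'`, take one `ε` admissible for both. The loop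
around `y ∈ Y` is then the same in both complements, and the loop around a point of `Y' \ Y` misses
all cuts of `Y`, so it is null-homotopic there. -/

open Topology unitInterval

/-! ### Homotopy classes of paths and subpaths -/

namespace Path.Homotopic.Quotient

variable {X : Type*} [TopologicalSpace X]

/-- The endpoint `c` is kept apart from `p t` so that `t = 1` can be used with the actual target of
the path. -/
theorem mk_subpath_trans {a b c : X} (p : Path a b) (s t : I) (h : p t = c) :
    (mk ((p.subpath 0 s).cast p.source.symm rfl)).trans (mk ((p.subpath s t).cast rfl h.symm)) =
      mk ((p.subpath 0 t).cast p.source.symm h.symm) := by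
  subst h
  rw [← mk_trans, eq]
  exact ⟨Path.Homotopy.subpathTransSubpath p 0 s t⟩

theorem mk_subpath_zero_one {a b : X} (p : Path a b) :
    mk ((p.subpath 0 1).cast p.source.symm p.target.symm) = mk p := by
  congr 1
  ext t
  simp

theorem trans_symm_rev {a b c : X} (p : Path.Homotopic.Quotient a b)
    (q : Path.Homotopic.Quotient b c) : (p.trans q).symm = q.symm.trans p.symm := by
  induction p using Path.Homotopic.Quotient.ind
  induction q using Path.Homotopic.Quotient.ind
  rw [← mk_trans, ← mk_symm, Path.trans_symm]
  rfl

theorem symm_symm_eq {a b : X} (p : Path.Homotopic.Quotient a b) : p.symm.symm = p := by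
  induction p using Path.Homotopic.Quotient.ind
  rw [← mk_symm, ← mk_symm, Path.symm_symm]

end Path.Homotopic.Quotient

theorem IsSimplyConnected.mk_eq {X : Type*} [TopologicalSpace X] {S : Set X}
    (hS : IsSimplyConnected S) {a b : X} (p q : Path a b) (hp : ∀ t, p t ∈ S)
    (hq : ∀ t, q t ∈ S) :
    Path.Homotopic.Quotient.mk p = Path.Homotopic.Quotient.mk q := by
  rw [Path.Homotopic.Quotient.eq]
  have := hS.simplyConnectedSpace
  have ha : a ∈ S := by simpa using hp 0
  have hb : b ∈ S := by simpa using hp 1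
  let p' : Path (⟨a, ha⟩ : S) ⟨b, hb⟩ :=
    ⟨⟨fun t => ⟨p t, hp t⟩, by fun_prop⟩, by simp, by simp⟩
  let q' : Path (⟨a, ha⟩ : S) ⟨b, hb⟩ :=
    ⟨⟨fun t => ⟨q t, hq t⟩, by fun_prop⟩, by simp, by simp⟩
  exact (SimplyConnectedSpace.paths_homotopic p' q').map ⟨Subtype.val, continuous_subtype_val⟩

/-! ### Generation by crossing loops -/

/-- A subgroup `H` of the fundamental group is everything as soon as there are local choices of
return paths to the base point, which are compatible up to `H`. -/
theorem FundamentalGroup.eq_top_of_returns {X ι : Type*} [TopologicalSpace X] {x₀ : X}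
    (base : ι → Set X) (hopen : ∀ i, IsOpen (base i)) (hcover : ∀ x, ∃ i, x ∈ base i)
    (H : Subgroup (FundamentalGroup X x₀))
    (ret : ∀ i z, z ∈ base i → Path.Homotopic.Quotient z x₀)
    (hpath : ∀ i a b (ha : a ∈ base i) (hb : b ∈ base i) (p : Path a b), (∀ t, p t ∈ base i) →
      (Path.Homotopic.Quotient.mk p).trans (ret i b hb) = ret i a ha)
    (htrans : ∀ i k z (hi : z ∈ base i) (hk : z ∈ base k),
      FundamentalGroup.fromPath ((ret i z hi).symm.trans (ret k z hk)) ∈ H)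
    (h₀ : ∃ i h, ret i x₀ h = Path.Homotopic.Quotient.refl x₀) : H = ⊤ := by
  rw [eq_top_iff]
  rintro g -
  induction g using Path.Homotopic.Quotient.ind with
  | mk p =>
  let q : ∀ t : I, Path.Homotopic.Quotient x₀ (p t) := fun t =>
    .mk ((p.subpath 0 t).cast p.source.symm rfl)
  choose idx hidx using fun t => hcover (p t)
  have key : ∀ t i k (hi : p t ∈ base i) (hk : p t ∈ base k),
      FundamentalGroup.fromPath ((q t).trans (ret i _ hi)) ∈ H →
      FundamentalGroup.fromPath ((q t).trans (ret k _ hk)) ∈ H := by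
    intro t i k hi hk h
    -- In a product of the fundamental group, the right factor is traversed first.
    have := H.mul_mem (htrans i k _ hi hk) h
    rw [FundamentalGroup.mul_def] at this
    convert this using 1
    change _ = Path.Homotopic.Quotient.trans (Path.Homotopic.Quotient.trans _ _)
      (Path.Homotopic.Quotient.trans _ _)
    grind
  -- `P t` says that following `p` up to `t` and then returning gives an element of `H`. It is
  -- locally constant, hence constant on the interval. At `0` the loop is trivial, at `1` it is `p`.
  let P : I → Prop := fun t => FundamentalGroup.fromPath ((q t).trans (ret _ _ (hidx t))) ∈ H
  have hP : IsLocallyConstant P := by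
    rw [IsLocallyConstant.iff_eventually_eq]
    intro t
    have hN : p ⁻¹' base (idx t) ∈ 𝓝 t :=
      ((hopen _).preimage p.continuous).mem_nhds (hidx t)
    obtain ⟨r, hr, hW⟩ := Metric.mem_nhds_iff.1 hN
    filter_upwards [Metric.ball_mem_nhds t hr] with s hs
    have hsub : ∀ r, p.subpath t s r ∈ base (idx t) := by
      intro r
      have : p.subpath t s r ∈ Set.range (p.subpath t s) := ⟨r, rfl⟩
      rw [Path.range_subpath] at this
      obtain ⟨r', hr', h⟩ := this
      rw [← h]
      refine hW (Metric.mem_ball.2 (lt_of_le_of_lt ?_ (Metric.mem_ball.1 hs)))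
      have h' : (r' : ℝ) ∈ Set.uIcc (t : ℝ) s := by
        rcases Set.mem_uIcc.1 hr' with h | h
        · exact Set.mem_uIcc.2 (Or.inl h)
        · exact Set.mem_uIcc.2 (Or.inr h)
      have := Set.abs_sub_left_of_mem_uIcc h'
      rwa [Subtype.dist_eq, Subtype.dist_eq, Real.dist_eq, Real.dist_eq]
    have hs' : p s ∈ base (idx t) := hW hs
    have e : (q s).trans (ret (idx t) _ hs') = (q t).trans (ret _ _ (hidx t)) := by
      rw [← hpath _ _ _ (hidx t) hs' _ hsub, ← Path.Homotopic.Quotient.trans_assoc]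
      congr 1
      exact (Path.Homotopic.Quotient.mk_subpath_trans p t s rfl).symm
    refine propext ⟨fun h => ?_, fun h => key s _ _ hs' _ ?_⟩
    · change _ ∈ H
      rw [← e]
      exact key s _ _ _ _ h
    · rw [e]; exact h
  obtain ⟨i₀, hi₀, hret⟩ := h₀
  have hend : ∀ t (e : p t = x₀), P t ↔ FundamentalGroup.fromPath
      (.mk ((p.subpath 0 t).cast p.source.symm e.symm)) ∈ H := by
    intro t e
    have hi : p t ∈ base i₀ := by rwa [e]
    have h1 : ret i₀ (p t) hi = .mk ((Path.refl x₀).cast e rfl) := by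
      rw [← hpath i₀ _ _ hi hi₀ ((Path.refl x₀).cast e rfl) (by simpa using hi₀), hret,
        Path.Homotopic.Quotient.trans_refl]
    have h2 : (q t).trans (ret i₀ _ hi) =
        .mk ((p.subpath 0 t).cast p.source.symm e.symm) := by
      rw [h1, ← Path.Homotopic.Quotient.mk_trans]
      have : ∀ {a b c : X} (γ : Path a b) (h : b = c),
          Path.Homotopic.Quotient.mk (γ.trans ((Path.refl c).cast h rfl)) =
            .mk (γ.cast rfl h.symm) := by
        intro a b c γ h
        subst h
        simp
      exact this ((p.subpath 0 t).cast p.source.symm rfl) e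
    rw [← h2]
    exact ⟨key t _ _ _ _, key t _ _ _ _⟩
  have hP1 : P 1 := by
    rw [hP.apply_eq_of_preconnectedSpace 1 0, hend 0 p.source]
    convert H.one_mem
    rw [FundamentalGroup.one_def]
    change Path.Homotopic.Quotient.mk _ = .mk _
    congr 1
    ext t
    simp
  rw [hend 1 p.target] at hP1
  rwa [Path.Homotopic.Quotient.mk_subpath_zero_one] at hP1

/-- A presentation of a pointed space as a simply connected open set `U` glued to pairwise disjoint
simply connected open sets `V j` along two path connected pieces `L j` and `R j`, together with
loops which run in `U` from the base point to `L j`, cross `V j` from `L j` to `R j`, and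
return in `U`. -/
structure CutDecomposition (X : Type*) [TopologicalSpace X] (x₀ : X) (J : Type*) where ofData ::
  U : Set X
  V : J → Set X
  L : J → Set X
  R : J → Set X
  isOpen_U : IsOpen U
  isOpen_V : ∀ j, IsOpen (V j)
  isOpen_L : ∀ j, IsOpen (L j)
  isOpen_R : ∀ j, IsOpen (R j)
  cover : ∀ x, x ∈ U ∨ ∃ j, x ∈ V j
  disjoint_V : ∀ i j, i ≠ j → Disjoint (V i) (V j)
  inter_eq : ∀ j, U ∩ V j = L j ∪ R j
  disjoint_LR : ∀ j, Disjoint (L j) (R j)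
  isSimplyConnected_U : IsSimplyConnected U
  isSimplyConnected_V : ∀ j, IsSimplyConnected (V j)
  isPathConnected_L : ∀ j, IsPathConnected (L j)
  isPathConnected_R : ∀ j, IsPathConnected (R j)
  l : J → X
  r : J → X
  l_mem : ∀ j, l j ∈ L j
  r_mem : ∀ j, r j ∈ R j
  a : ∀ j, Path x₀ (l j)
  b : ∀ j, Path (l j) (r j)
  c : ∀ j, Path (r j) x₀
  a_mem : ∀ j t, a j t ∈ U
  b_mem : ∀ j t, b j t ∈ V j
  c_mem : ∀ j t, c j t ∈ U
  base_mem : x₀ ∈ U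

namespace CutDecomposition

open Path.Homotopic.Quotient

variable {X : Type*} [TopologicalSpace X] {x₀ : X} {J : Type*} (D : CutDecomposition X x₀ J)

/-- The class of the loop crossing `V j`. -/
noncomputable def loop (j : J) : FundamentalGroup X x₀ :=
  FundamentalGroup.fromPath ((mk (D.a j)).trans ((mk (D.b j)).trans (mk (D.c j))))

/-- The covering of the space by `U` and the sets `V j`. -/
def base : Option J → Set X
  | none => D.U
  | some j => D.V j

theorem isOpen_base : ∀ i, IsOpen (D.base i)
  | none => D.isOpen_U
  | some j => D.isOpen_V j

theorem exists_mem_base (x : X) : ∃ i, x ∈ D.base i := by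
  rcases D.cover x with h | ⟨j, h⟩
  exacts [⟨none, h⟩, ⟨some j, h⟩]

theorem subset_L (j : J) : D.L j ⊆ D.U ∩ D.V j := by
  rw [D.inter_eq]; exact Set.subset_union_left

theorem subset_R (j : J) : D.R j ⊆ D.U ∩ D.V j := by
  rw [D.inter_eq]; exact Set.subset_union_right

/-- The return path to the base point from a point of `D.base i`. -/
noncomputable def ret : ∀ i z, z ∈ D.base i → Path.Homotopic.Quotient z x₀
  | none, z, h => mk (D.isSimplyConnected_U.isPathConnected.joinedIn z h x₀ D.base_mem).somePath
  | some j, z, h =>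
    (mk ((D.isSimplyConnected_V j).isPathConnected.joinedIn z h (D.l j)
      (D.subset_L j (D.l_mem j)).2).somePath).trans (mk (D.a j)).symm

theorem ret_none {z : X} (h : z ∈ D.U) (p : Path z x₀) (hp : ∀ t, p t ∈ D.U) :
    D.ret none z h = mk p :=
  D.isSimplyConnected_U.mk_eq _ _ (JoinedIn.somePath_mem _) hp

theorem ret_some {j : J} {z : X} (h : z ∈ D.V j) (p : Path z (D.l j)) (hp : ∀ t, p t ∈ D.V j) :
    D.ret (some j) z h = (mk p).trans (mk (D.a j)).symm :=
  congrArg (fun q => q.trans (mk (D.a j)).symm)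
    ((D.isSimplyConnected_V j).mk_eq _ _ (JoinedIn.somePath_mem _) hp)

theorem trans_mem {S : Set X} {x y z : X} {p : Path x y} {q : Path y z} (hp : ∀ t, p t ∈ S)
    (hq : ∀ t, q t ∈ S) (t : I) : p.trans q t ∈ S := by
  rw [Path.trans_apply]
  split_ifs
  exacts [hp _, hq _]

theorem mk_trans_ret (i : Option J) (x y : X) (hx : x ∈ D.base i) (hy : y ∈ D.base i)
    (p : Path x y) (hp : ∀ t, p t ∈ D.base i) : (mk p).trans (D.ret i y hy) = D.ret i x hx := by
  match i with
  | none =>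
    have hj := D.isSimplyConnected_U.isPathConnected.joinedIn y hy x₀ D.base_mem
    rw [D.ret_none hy hj.somePath hj.somePath_mem, ← mk_trans]
    exact (D.ret_none hx _ (trans_mem hp hj.somePath_mem)).symm
  | some j =>
    have hj := (D.isSimplyConnected_V j).isPathConnected.joinedIn y hy (D.l j)
      (D.subset_L j (D.l_mem j)).2
    rw [D.ret_some hy hj.somePath hj.somePath_mem, ← Path.Homotopic.Quotient.trans_assoc,
      ← mk_trans]
    exact (D.ret_some hx _ (trans_mem hp hj.somePath_mem)).symm

/-- Return paths may be chosen freely within `U` and `V j`. From a point of `L j`, both can go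
through `l j` and back along `a j`, so they agree. From a point of `R j`, both can go to `r j` and
then differ by the inverse of the crossing loop. -/
theorem ret_symm_trans_ret_mem (H : Subgroup (FundamentalGroup X x₀)) (hH : ∀ j, D.loop j ∈ H)
    (j : J) (z : X) (h : z ∈ D.U) (h' : z ∈ D.V j) :
    FundamentalGroup.fromPath ((D.ret none z h).symm.trans (D.ret (some j) z h')) ∈ H := by
  have hz : z ∈ D.L j ∪ D.R j := by rw [← D.inter_eq]; exact ⟨h, h'⟩
  rcases hz with hz | hz
  · have hj := (D.isPathConnected_L j).joinedIn z hz _ (D.l_mem j)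
    rw [D.ret_some h' hj.somePath fun t => (D.subset_L j (hj.somePath_mem t)).2,
      D.ret_none h (hj.somePath.trans (D.a j).symm)
        (trans_mem (fun t => (D.subset_L j (hj.somePath_mem t)).1) fun t => D.a_mem j _)]
    convert H.one_mem
    change _ = refl x₀
    rw [mk_trans, mk_symm, symm_trans]
  · have hj := (D.isPathConnected_R j).joinedIn z hz _ (D.r_mem j)
    rw [D.ret_some h' (hj.somePath.trans (D.b j).symm)
        (trans_mem (fun t => (D.subset_R j (hj.somePath_mem t)).2) fun t => D.b_mem j _),
      D.ret_none h (hj.somePath.trans (D.c j))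
        (trans_mem (fun t => (D.subset_R j (hj.somePath_mem t)).1) (D.c_mem j))]
    convert H.inv_mem (hH j)
    rw [FundamentalGroup.inv_def]
    change Path.Homotopic.Quotient.trans _ _ = Path.Homotopic.Quotient.symm
      (Path.Homotopic.Quotient.trans _ _)
    simp only [mk_trans, mk_symm, trans_symm_rev]
    grind

theorem closure_range_loop : Subgroup.closure (Set.range D.loop) = ⊤ := by
  have hmem : ∀ j, D.loop j ∈ Subgroup.closure (Set.range D.loop) :=
    fun j => Subgroup.subset_closure ⟨j, rfl⟩
  refine FundamentalGroup.eq_top_of_returns D.base D.isOpen_base D.exists_mem_base _ D.ret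
    D.mk_trans_ret ?_ ⟨none, D.base_mem, D.ret_none D.base_mem (Path.refl x₀) fun _ => D.base_mem⟩
  intro i k z hi hk
  have hself : ∀ q : Path.Homotopic.Quotient z x₀, FundamentalGroup.fromPath
      (q.symm.trans q) ∈ Subgroup.closure (Set.range D.loop) := by
    intro q
    rw [Path.Homotopic.Quotient.symm_trans]
    exact Subgroup.one_mem _
  match i, k with
  | none, none => exact hself _
  | none, some j => exact D.ret_symm_trans_ret_mem _ hmem j z hi hk
  | some j, none =>
    convert Subgroup.inv_mem _ (D.ret_symm_trans_ret_mem _ hmem j z hk hi)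
    rw [FundamentalGroup.inv_def]
    change _ = Path.Homotopic.Quotient.symm (Path.Homotopic.Quotient.trans _ _)
    rw [trans_symm_rev, symm_symm_eq]
  | some j, some j' =>
    by_cases hjj : j = j'
    · subst hjj; exact hself _
    · exact ((D.disjoint_V j j' hjj).ne_of_mem hi hk rfl).elim

end CutDecomposition

/-! ### The free covering and independence of the loops -/

/-- In a covering space given by a cocycle, the lifts of a path in a chart domain are
constant in this chart. -/
theorem FiberBundleCore.monodromy_mk {ι B F : Type*} [TopologicalSpace B] [TopologicalSpace F]
    [DiscreteTopology F] (Z : FiberBundleCore ι B F) (cov : IsCoveringMap Z.proj) (i : ι)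
    {x y : B} (p : Path x y) (hp : ∀ t, p t ∈ Z.baseSet i) (v : F) :
    cov.monodromy (.mk p) ⟨⟨x, Z.coordChange i (Z.indexAt x) x v⟩, rfl⟩ =
      ⟨⟨y, Z.coordChange i (Z.indexAt y) y v⟩, rfl⟩ := by
  let q : Path (⟨x, Z.coordChange i (Z.indexAt x) x v⟩ : Z.TotalSpace)
      ⟨y, Z.coordChange i (Z.indexAt y) y v⟩ :=
    { toFun := fun t => (Z.localTriv i).toOpenPartialHomeomorph.symm (p t, v)
      continuous_toFun := by
        refine (Z.localTriv i).toOpenPartialHomeomorph.continuousOn_symm.comp_continuous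
          (by fun_prop) fun t => ?_
        rw [Bundle.Trivialization.mem_target]
        exact hp t
      source' := by rw [Path.source]; rfl
      target' := by rw [Path.target]; rfl }
  refine cov.monodromy_eq_of_map_eq (.mk q) ?_
  rw [Path.Homotopic.Quotient.cast_rfl_rfl]
  change Path.Homotopic.Quotient.mk _ = .mk _
  congr 1

namespace CutDecomposition

variable {X : Type*} [TopologicalSpace X] {x₀ : X} {J : Type*} (D : CutDecomposition X x₀ J)

open Classical in
/-- The cochain whose coboundary is the cocycle of the free covering. -/
noncomputable def cochain : Option J → X → FreeGroup J
  | none, _ => 1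
  | some j, x => if x ∈ D.R j then FreeGroup.of j else 1

/-- The discrete topology on the free group. -/
abbrev discreteFree (J : Type*) : TopologicalSpace (FreeGroup J) := ⊥

attribute [local instance] discreteFree

theorem continuousOn_cochain (j : J) : ContinuousOn (D.cochain (some j)) (D.U ∩ D.V j) := by
  rw [D.inter_eq]
  have hL : ContinuousOn (D.cochain (some j)) (D.L j) :=
    continuousOn_const.congr fun x hx =>
      if_neg fun h => (D.disjoint_LR j).ne_of_mem hx h rfl
  have hR : ContinuousOn (D.cochain (some j)) (D.R j) :=
    continuousOn_const.congr fun x hx => if_pos hx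
  exact hL.union_of_isOpen hR (D.isOpen_L j) (D.isOpen_R j)

/-- The free covering as a bundle of free groups. -/
noncomputable def core : FiberBundleCore (Option J) X (FreeGroup J) where
  baseSet := D.base
  isOpen_baseSet := D.isOpen_base
  indexAt x := (D.exists_mem_base x).choose
  mem_baseSet_at x := (D.exists_mem_base x).choose_spec
  -- The coordinate `g` in chart `i` stands for `cochain i x * g`, so the cocycle identities are
  -- automatic. The cochain need only be locally constant on overlaps. It may jump inside `V j`
  -- between `L j` and `R j`, which is what creates monodromy.
  coordChange i k x g := (D.cochain k x)⁻¹ * (D.cochain i x * g)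
  coordChange_self i x _ g := by simp
  coordChange_comp i j k x _ g := by simp
  continuousOn_coordChange i k := by
    have : DiscreteTopology (FreeGroup J) := ⟨rfl⟩
    have hmul : ∀ f : X → FreeGroup J, ContinuousOn f (D.base i ∩ D.base k) →
        ContinuousOn (fun p : X × FreeGroup J => f p.1 * p.2)
          ((D.base i ∩ D.base k) ×ˢ Set.univ) := by
      intro f hf
      exact (continuous_of_discreteTopology (f := fun q : FreeGroup J × FreeGroup J =>
        q.1 * q.2)).comp_continuousOn
          ((hf.comp continuousOn_fst fun p hp => hp.1).prodMk continuousOn_snd)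
    simp only [← mul_assoc]
    apply hmul fun x => (D.cochain k x)⁻¹ * D.cochain i x
    match i, k with
    | none, none => exact continuousOn_const
    | none, some j =>
      exact (continuous_of_discreteTopology (f := fun g : FreeGroup J =>
        g⁻¹ * 1)).comp_continuousOn (D.continuousOn_cochain j)
    | some j, none =>
      exact (continuous_of_discreteTopology (f := fun g : FreeGroup J =>
        1⁻¹ * g)).comp_continuousOn (Set.inter_comm _ _ ▸ D.continuousOn_cochain j)
    | some j, some j' =>
      by_cases hjj : j = j'
      · subst hjj
        simp only [inv_mul_cancel]
        exact continuousOn_const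
      · rw [show D.base (some j) ∩ D.base (some j') = ∅ from
          (D.disjoint_V j j' hjj).inter_eq]
        exact continuousOn_empty _

theorem isCoveringMap_core : IsCoveringMap D.core.proj :=
  have : DiscreteTopology (FreeGroup J) := ⟨rfl⟩
  FiberBundle.isCoveringMap

/-- The point of the free covering over `x` with coordinate `g` in the chart `i`. -/
noncomputable def coverPoint (i : Option J) (x : X) (g : FreeGroup J) : D.core.proj ⁻¹' {x} :=
  ⟨⟨x, D.core.coordChange i (D.core.indexAt x) x g⟩, rfl⟩

theorem coverPoint_eq {i k : Option J} {x : X} {g h : FreeGroup J}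
    (e : D.cochain i x * g = D.cochain k x * h) : D.coverPoint i x g = D.coverPoint k x h :=
  Subtype.ext (congrArg (fun v => (⟨x, (D.cochain _ x)⁻¹ * v⟩ : D.core.TotalSpace)) e)

theorem coverPoint_injective (i : Option J) (x : X) :
    Function.Injective (D.coverPoint i x) := by
  intro g h e
  have := congrArg (fun v : D.core.proj ⁻¹' {x} => (show FreeGroup J from v.1.2)) e
  change (D.cochain _ x)⁻¹ * (D.cochain i x * g) = (D.cochain _ x)⁻¹ * (D.cochain i x * h) at this
  exact mul_left_cancel (mul_left_cancel this)

theorem monodromy_mk (i : Option J) {x y : X} (p : Path x y) (hp : ∀ t, p t ∈ D.base i)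
    (g : FreeGroup J) :
    D.isCoveringMap_core.monodromy (.mk p) (D.coverPoint i x g) = D.coverPoint i y g :=
  have : DiscreteTopology (FreeGroup J) := ⟨rfl⟩
  D.core.monodromy_mk D.isCoveringMap_core i p hp g

/-- The coordinate is constant along each of the three pieces. Passing from `U` to `V j` at `l j`
does not change it, since the cochain is `1` on `L j`. Passing back at `r j` multiplies it by the
generator. -/
theorem monodromyPerm_loop (j : J) (g : FreeGroup J) :
    D.isCoveringMap_core.monodromyPerm x₀ (D.loop j) (D.coverPoint none x₀ g) =
      D.coverPoint none x₀ (FreeGroup.of j * g) := by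
  rw [IsCoveringMap.coe_monodromyPerm, loop, FundamentalGroup.fromPath,
    FundamentalGroup.fromArrow, IsCoveringMap.monodromy_trans_apply,
    IsCoveringMap.monodromy_trans_apply, D.monodromy_mk none _ (D.a_mem j)]
  have hl : D.l j ∉ D.R j := fun h => (D.disjoint_LR j).ne_of_mem (D.l_mem j) h rfl
  rw [D.coverPoint_eq (i := none) (k := some j) (h := g) (by simp [cochain, hl]),
    D.monodromy_mk (some j) _ (D.b_mem j),
    D.coverPoint_eq (i := some j) (k := none) (h := FreeGroup.of j * g)
      (by simp [cochain, D.r_mem j]), D.monodromy_mk none _ (D.c_mem j)]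

theorem monodromyPerm_lift (w g : FreeGroup J) :
    D.isCoveringMap_core.monodromyPerm x₀ (FreeGroup.lift D.loop w) (D.coverPoint none x₀ g) =
      D.coverPoint none x₀ (w * g) := by
  induction w using FreeGroup.induction_on generalizing g with
  | C1 => rw [map_one, map_one, Equiv.Perm.one_apply, one_mul]
  | of j => simpa using D.monodromyPerm_loop j g
  | inv_of j _ =>
    rw [map_inv, map_inv, Equiv.Perm.inv_eq_iff_eq, FreeGroup.lift_apply_of,
      D.monodromyPerm_loop, mul_inv_cancel_left]
  | mul v w hv hw => rw [map_mul, map_mul, Equiv.Perm.mul_apply, hw, hv, mul_assoc]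

/-- The fundamental group is free on the crossing loops. -/
noncomputable def freeGroupEquiv : FreeGroup J ≃* FundamentalGroup X x₀ :=
  MulEquiv.ofBijective (FreeGroup.lift D.loop) <| by
    constructor
    · intro v w h
      have := D.monodromyPerm_lift v 1
      rw [h, D.monodromyPerm_lift] at this
      simpa using (D.coverPoint_injective none x₀ this).symm
    · rw [← MonoidHom.range_eq_top, FreeGroup.range_lift_eq_closure, D.closure_range_loop]

theorem freeGroupEquiv_of (j : J) : D.freeGroupEquiv (FreeGroup.of j) = D.loop j :=
  FreeGroup.lift_apply_of (f := D.loop) (x := j)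

end CutDecomposition

/-! ### Spiral coordinates and separation of sectors -/

/-- The twist of the plane which turns the circle of radius `r` by the angle `ε * r`. -/
noncomputable def twist (ε : ℝ) : ℂ ≃ₜ ℂ where
  toFun z := z * Complex.exp ((ε * ‖z‖ : ℝ) * Complex.I)
  invFun z := z * Complex.exp ((-(ε * ‖z‖) : ℝ) * Complex.I)
  left_inv z := by
    simp only [norm_mul, Complex.norm_exp_ofReal_mul_I, mul_one, mul_assoc, ← Complex.exp_add]
    simp
  right_inv z := by
    simp only [norm_mul, Complex.norm_exp_ofReal_mul_I, mul_one, mul_assoc, ← Complex.exp_add]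
    simp
  continuous_toFun := by fun_prop
  continuous_invFun := by fun_prop

/-- The twist of the plane around `x₀`, followed by the translation of `x₀` to the origin. -/
noncomputable def spiral (x₀ : ℂ) (ε : ℝ) : ℂ ≃ₜ ℂ :=
  (Homeomorph.subRight x₀).trans (twist ε)

theorem spiral_apply (x₀ : ℂ) (ε : ℝ) (z : ℂ) :
    spiral x₀ ε z = (z - x₀) * Complex.exp ((ε * ‖z - x₀‖ : ℝ) * Complex.I) := rfl

theorem spiral_symm_apply (x₀ : ℂ) (ε : ℝ) (w : ℂ) :
    (spiral x₀ ε).symm w = w * Complex.exp ((-(ε * ‖w‖) : ℝ) * Complex.I) + x₀ := rfl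

theorem spiral_self (x₀ : ℂ) (ε : ℝ) : spiral x₀ ε x₀ = 0 := by simp [spiral_apply]

theorem spiral_ne_zero {x₀ z : ℂ} (ε : ℝ) (h : z ≠ x₀) : spiral x₀ ε z ≠ 0 := by
  rw [← spiral_self x₀ ε]
  exact (spiral x₀ ε).injective.ne h

/-- The open sector around the positive real axis with slope less than `η`. -/
def sector (η : ℝ) : Set ℂ := {u | |u.im| < η * u.re}

/-- The part of the real axis to the right of `1`. -/
def cut : Set ℂ := {u | u.im = 0 ∧ 1 ≤ u.re}

theorem re_pos_of_mem_sector {η : ℝ} (hη : 0 < η) {u : ℂ} (hu : u ∈ sector η) : 0 < u.re :=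
  pos_of_mul_pos_right ((abs_nonneg _).trans_lt hu) hη.le

theorem cut_subset_sector {η : ℝ} (hη : 0 < η) : cut ⊆ sector η := by
  rintro u ⟨h, h'⟩
  change |u.im| < η * u.re
  rw [h, abs_zero]
  exact mul_pos hη (by linarith)

theorem one_mem_cut : (1 : ℂ) ∈ cut := by simp [cut]

theorem zero_notMem_cut : (0 : ℂ) ∉ cut := by simp [cut]

/-- If `w = a * u = b * v`, then `a * star b` is a positive multiple of `v * star u`. The latter has
imaginary part at most `2 * η` and real part at least `3 / 4`, in units of `v.re * u.re`, and `2 ≤ 3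
* (3 / 4)`. -/
theorem mem_sector_of_div {η : ℝ} (hη : 0 < η) (hη' : η ≤ 1 / 2) {a b w : ℂ} (ha : a ≠ 0)
    (hb : b ≠ 0) (h : w / a ∈ sector η) (h' : w / b ∈ sector η) :
    0 < (a * star b).re ∧ |(a * star b).im| ≤ 3 * η * (a * star b).re := by
  obtain ⟨u, rfl⟩ : ∃ u, w = a * u := ⟨w / a, by field_simp⟩
  rw [mul_div_cancel_left₀ _ ha] at h
  obtain ⟨v, hv⟩ : ∃ v, a * u = b * v := ⟨a * u / b, by field_simp⟩
  rw [hv, mul_div_cancel_left₀ _ hb] at h'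
  have hu := re_pos_of_mem_sector hη h
  have hv' := re_pos_of_mem_sector hη h'
  have hnu : 0 < Complex.normSq u := Complex.normSq_pos.2 fun e => by simp [e] at hu
  have hnb : 0 < Complex.normSq b := Complex.normSq_pos.2 hb
  have key : a * star b = (Complex.normSq b / Complex.normSq u : ℝ) * (v * star u) := by
    have e1 : star b * b = Complex.normSq b := Complex.normSq_eq_conj_mul_self.symm
    have e2 : u * star u = Complex.normSq u := Complex.mul_conj u
    have : (Complex.normSq u : ℂ) ≠ 0 := by exact_mod_cast hnu.ne'
    push_cast
    field_simp
    rw [← e1, ← e2]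
    linear_combination (star b * star u) * hv
  rw [key, Complex.re_ofReal_mul, Complex.im_ofReal_mul, abs_mul]
  have hk : 0 < Complex.normSq b / Complex.normSq u := div_pos hnb hnu
  rw [abs_of_pos hk]
  have h1 : (v * star u).re = v.re * u.re + v.im * u.im := by simp
  have h2 : (v * star u).im = v.im * u.re - v.re * u.im := by simp; ring
  change |u.im| < η * u.re at h
  change |v.im| < η * v.re at h'
  have hp : 0 < v.re * u.re := mul_pos hv' hu
  have h3 : |v.im * u.im| ≤ 1 / 4 * (v.re * u.re) := by
    rw [abs_mul]
    calc |v.im| * |u.im| ≤ (η * v.re) * (η * u.re) := by gcongr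
      _ = (η * η) * (v.re * u.re) := by ring
      _ ≤ (1 / 2 * (1 / 2)) * (v.re * u.re) := by gcongr
      _ = _ := by ring
  have h4 : |v.im * u.re - v.re * u.im| ≤ 2 * η * (v.re * u.re) := by
    refine (abs_sub _ _).trans ?_
    rw [abs_mul, abs_mul, abs_of_pos hu, abs_of_pos hv']
    nlinarith
  have h5 := neg_abs_le (v.im * u.im)
  rw [h1, h2]
  have h6 : 3 / 4 * (v.re * u.re) ≤ v.re * u.re + v.im * u.im := by linarith
  refine ⟨mul_pos hk (by linarith), ?_⟩
  rw [mul_left_comm]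
  gcongr
  refine h4.trans ?_
  nlinarith

/-- A common point would put `p`, rotated by `ε * d`, into a sector of slope `3 * ε ^ 2`. If `p` is
not a positive real, this fails in the limit. If it is, the two points are aligned with `x₀` and `d
≠ 0`, so the rotation of order `ε` beats the slope of order `ε ^ 2`. -/
theorem eventually_not_mem_sector {x₀ y y' : ℂ} (hy : y ≠ x₀) (hy' : y' ≠ x₀) (hyy : y ≠ y') :
    ∀ᶠ ε : ℝ in 𝓝[>] 0, ∀ w, w / spiral x₀ ε y ∈ sector (ε ^ 2) →
      w / spiral x₀ ε y' ∉ sector (ε ^ 2) := by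
  set A := y - x₀
  set B := y' - x₀
  have hA : A ≠ 0 := sub_ne_zero.2 hy
  have hB : B ≠ 0 := sub_ne_zero.2 hy'
  set p := A * star B with hp
  set d := ‖A‖ - ‖B‖ with hd
  have hm : ∀ ε : ℝ, spiral x₀ ε y * star (spiral x₀ ε y') =
      p * Complex.exp ((ε * d : ℝ) * Complex.I) := by
    intro ε
    rw [spiral_apply, spiral_apply]
    change A * _ * star (B * _) = _
    rw [star_mul', hp, hd]
    change A * _ * (star B * (starRingEnd ℂ) (Complex.exp _)) = _
    rw [← Complex.exp_conj, map_mul, Complex.conj_I, Complex.conj_ofReal]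
    rw [mul_mul_mul_comm, ← Complex.exp_add]
    congr 2
    push_cast
    ring
  have hre : ∀ ε : ℝ, (p * Complex.exp ((ε * d : ℝ) * Complex.I)).re =
      p.re * Real.cos (ε * d) - p.im * Real.sin (ε * d) := by
    intro ε
    rw [Complex.mul_re, Complex.exp_ofReal_mul_I_re, Complex.exp_ofReal_mul_I_im]
  have him : ∀ ε : ℝ, (p * Complex.exp ((ε * d : ℝ) * Complex.I)).im =
      p.re * Real.sin (ε * d) + p.im * Real.cos (ε * d) := by
    intro ε
    rw [Complex.mul_im, Complex.exp_ofReal_mul_I_re, Complex.exp_ofReal_mul_I_im]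
  suffices h : ∀ᶠ ε : ℝ in 𝓝[>] 0, ¬ (0 < p.re * Real.cos (ε * d) - p.im * Real.sin (ε * d) ∧
      |p.re * Real.sin (ε * d) + p.im * Real.cos (ε * d)| ≤
        3 * ε ^ 2 * (p.re * Real.cos (ε * d) - p.im * Real.sin (ε * d))) by
    filter_upwards [h, self_mem_nhdsWithin, Ioo_mem_nhdsGT (show (0 : ℝ) < 1 / 2 by norm_num)]
      with ε hε hpos hlt w hw hw'
    have hpos : 0 < ε := hpos
    have := mem_sector_of_div (by positivity) (by nlinarith [hlt.2]) (spiral_ne_zero ε hy)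
      (spiral_ne_zero ε hy') hw hw'
    rw [hm, hre, him] at this
    exact hε this
  by_cases hpi : p.im = 0
  · rcases le_or_gt p.re 0 with hpr | hpr
    · have hpr : p.re < 0 := lt_of_le_of_ne hpr fun e => mul_ne_zero hA (star_ne_zero.2 hB)
        (Complex.ext e hpi)
      have ht : Filter.Tendsto (fun ε : ℝ => p.re * Real.cos (ε * d) - p.im * Real.sin (ε * d))
          (𝓝[>] 0) (𝓝 p.re) := by
        refine (Continuous.tendsto' (by fun_prop) 0 _ (by simp)).mono_left nhdsWithin_le_nhds
      filter_upwards [ht.eventually (gt_mem_nhds hpr)] with ε h hε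
      exact lt_asymm h hε.1
    · have hd0 : d ≠ 0 := by
        intro h0
        have hn : ‖A‖ = ‖B‖ := sub_eq_zero.1 h0
        have hpe : p = (p.re : ℂ) := Complex.ext rfl (by simpa using hpi)
        have hnp : ‖p‖ = p.re := by rw [hpe]; simp [abs_of_pos hpr]
        have : A * star B = B * star B := by
          rw [← hp, hpe, ← hnp, hp, norm_mul, norm_star, hn]
          have : B * star B = Complex.normSq B := Complex.mul_conj B
          rw [this, Complex.normSq_eq_norm_sq]
          push_cast; ring
        have := mul_right_cancel₀ (star_ne_zero.2 hB) this
        exact hyy (sub_left_injective this)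
      have ht1 : ∀ᶠ ε : ℝ in 𝓝[>] 0, |ε * d| < 1 :=
        ((Continuous.tendsto' (f := fun ε : ℝ => |ε * d|) (by fun_prop) 0 0 (by simp)).mono_left
          nhdsWithin_le_nhds).eventually (gt_mem_nhds one_pos)
      -- By Jordan's inequality the sine is at least `ε * |d| / 2` in absolute value. A bound by `3
      -- * ε ^ 2` would force `|d| ≤ 6 * ε`.
      have ht2 : ∀ᶠ ε : ℝ in 𝓝[>] 0, 6 * ε < |d| :=
        ((Continuous.tendsto' (f := fun ε : ℝ => 6 * ε) (by fun_prop) 0 0 (by simp)).mono_left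
          nhdsWithin_le_nhds).eventually (gt_mem_nhds (abs_pos.2 hd0))
      filter_upwards [ht1, ht2, self_mem_nhdsWithin] with ε h1 h2 hpos hε
      have hpos : 0 < ε := hpos
      obtain ⟨-, hε⟩ := hε
      rw [hpi, zero_mul, zero_mul, sub_zero, add_zero, abs_mul, abs_of_pos hpr] at hε
      have h3 := Real.mul_abs_le_abs_sin (x := ε * d) (by linarith [Real.pi_gt_three])
      have h4 : (1 : ℝ) / 2 ≤ 2 / Real.pi := by
        rw [div_le_div_iff₀ two_pos Real.pi_pos]; linarith [Real.pi_le_four]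
      have h5 : 1 / 2 * |ε * d| ≤ |Real.sin (ε * d)| :=
        (mul_le_mul_of_nonneg_right h4 (abs_nonneg _)).trans h3
      rw [abs_mul, abs_of_pos hpos] at h5
      have h6 : |Real.sin (ε * d)| ≤ 3 * ε ^ 2 * Real.cos (ε * d) := by
        refine le_of_mul_le_mul_left ?_ hpr
        linarith
      have h7 : 3 * ε ^ 2 * Real.cos (ε * d) ≤ 3 * ε ^ 2 * 1 :=
        mul_le_mul_of_nonneg_left (Real.cos_le_one _) (by positivity)
      nlinarith
  · have ht : Filter.Tendsto (fun ε : ℝ => |p.re * Real.sin (ε * d) + p.im * Real.cos (ε * d)| -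
          3 * ε ^ 2 * (p.re * Real.cos (ε * d) - p.im * Real.sin (ε * d)))
        (𝓝[>] 0) (𝓝 |p.im|) := by
      refine (Continuous.tendsto' (by fun_prop) 0 _ (by simp)).mono_left nhdsWithin_le_nhds
    filter_upwards [ht.eventually (lt_mem_nhds (abs_pos.2 hpi))] with ε h hε
    linarith [hε.2]

/-- The sectors around the points of `Y` in spiral coordinates are pairwise disjoint. -/
def Separated (x₀ : ℂ) (ε : ℝ) (Y : Set ℂ) : Prop :=
  0 < ε ∧ ∀ y ∈ Y, ∀ y' ∈ Y, y ≠ y' → ∀ w, w / spiral x₀ ε y ∈ sector (ε ^ 2) →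
    w / spiral x₀ ε y' ∉ sector (ε ^ 2)

theorem exists_forall_separated {x₀ : ℂ} {Y : Set ℂ} (hY : Y.Finite) (hx₀ : x₀ ∉ Y) :
    ∃ ε₀ > 0, ∀ ε ∈ Set.Ioo 0 ε₀, Separated x₀ ε Y := by
  have h : ∀ᶠ ε : ℝ in 𝓝[>] 0, ∀ y ∈ Y, ∀ y' ∈ Y, y ≠ y' →
      ∀ w, w / spiral x₀ ε y ∈ sector (ε ^ 2) → w / spiral x₀ ε y' ∉ sector (ε ^ 2) := by
    rw [Filter.eventually_all_finite hY]
    intro y hy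
    rw [Filter.eventually_all_finite hY]
    intro y' hy'
    rw [Filter.eventually_imp_distrib_left]
    exact eventually_not_mem_sector (fun e => hx₀ (e ▸ hy)) (fun e => hx₀ (e ▸ hy'))
  obtain ⟨ε₀, h₀, hε₀⟩ := mem_nhdsGT_iff_exists_Ioo_subset.1 h
  exact ⟨ε₀, h₀, fun ε hε => ⟨hε.1, hε₀ hε⟩⟩

/-! ### Loops around the punctures -/

/-- A loop based at `0` in the plane, which runs around `1` inside a sector. -/
noncomputable def lune (δ t : ℝ) : ℂ := ⟨8 * t * (1 - t), 8 * t * (1 - t) * (δ * (2 * t - 1))⟩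

theorem lune_mem_sector {η t : ℝ} (hη : 0 < η) (ht : t ∈ Set.Ioo 0 1) :
    lune (η / 2) t ∈ sector η := by
  have h : 0 < 8 * t * (1 - t) := mul_pos (by linarith [ht.1]) (by linarith [ht.2])
  change |8 * t * (1 - t) * (η / 2 * (2 * t - 1))| < η * (8 * t * (1 - t))
  rw [abs_mul, abs_of_pos h, mul_comm η]
  gcongr
  rw [abs_lt]
  constructor <;> nlinarith [ht.1, ht.2]

theorem lune_zero (δ : ℝ) : lune δ 0 = 0 := by simp [lune, Complex.ext_iff]

theorem lune_one (δ : ℝ) : lune δ 1 = 0 := by simp [lune, Complex.ext_iff]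

/-- The curve meets the real axis only at `0`, for `t = 0` and `t = 1`, and at `2`, for `t = 1 / 2`.
-/
theorem lune_notMem_cut {δ t : ℝ} (hδ : δ ≠ 0) (ht : t ≠ 1 / 2) :
    lune δ t ∉ cut := by
  rintro ⟨h, h'⟩
  change 8 * t * (1 - t) * (δ * (2 * t - 1)) = 0 at h
  change 1 ≤ 8 * t * (1 - t) at h'
  have h1 : 2 * t - 1 ≠ 0 := fun e => ht (by linarith)
  have h2 : 8 * t * (1 - t) ≠ 0 := by linarith
  exact mul_ne_zero h2 (mul_ne_zero hδ h1) h

theorem lune_ne_one {δ t : ℝ} (hδ : δ ≠ 0) : lune δ t ≠ 1 := by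
  by_cases h : t = 1 / 2
  · intro e
    have := congrArg Complex.re e
    rw [h] at this
    norm_num [lune] at this
  · exact fun e => lune_notMem_cut hδ h (e ▸ one_mem_cut)

/-- The loop around `y` based at `x₀`, which runs inside a thin spiral sector. -/
noncomputable def spiralLoop (x₀ : ℂ) (ε : ℝ) (y : ℂ) (t : ℝ) : ℂ :=
  (spiral x₀ ε).symm (spiral x₀ ε y * lune (ε ^ 2 / 2) t)

/-- Continuity is joint because `ε` later serves as a homotopy parameter. -/
theorem continuous_spiralLoop (x₀ y : ℂ) :
    Continuous fun p : ℝ × ℝ => spiralLoop x₀ p.1 y p.2 := by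
  have : Continuous fun p : ℝ × ℝ => lune (p.1 ^ 2 / 2) p.2 := by
    refine Complex.equivRealProdCLM.symm.continuous.comp
      (f := fun p : ℝ × ℝ => (8 * p.2 * (1 - p.2), 8 * p.2 * (1 - p.2) *
        (p.1 ^ 2 / 2 * (2 * p.2 - 1)))) ?_
    fun_prop
  simp only [spiralLoop, spiral_apply, spiral_symm_apply]
  fun_prop

theorem spiralLoop_zero (x₀ : ℂ) (ε : ℝ) (y : ℂ) : spiralLoop x₀ ε y 0 = x₀ := by
  simp [spiralLoop, lune_zero, spiral_symm_apply]

theorem spiralLoop_one (x₀ : ℂ) (ε : ℝ) (y : ℂ) : spiralLoop x₀ ε y 1 = x₀ := by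
  simp [spiralLoop, lune_one, spiral_symm_apply]

theorem spiral_spiralLoop (x₀ : ℂ) (ε : ℝ) (y : ℂ) (t : ℝ) :
    spiral x₀ ε (spiralLoop x₀ ε y t) = spiral x₀ ε y * lune (ε ^ 2 / 2) t :=
  (spiral x₀ ε).apply_symm_apply _

theorem spiral_spiralLoop_div {x₀ y : ℂ} (hy : y ≠ x₀) (ε t : ℝ) :
    spiral x₀ ε (spiralLoop x₀ ε y t) / spiral x₀ ε y = lune (ε ^ 2 / 2) t := by
  rw [spiral_spiralLoop, mul_div_cancel_left₀ _ (spiral_ne_zero ε hy)]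

theorem Separated.spiralLoop_div_notMem_cut {x₀ : ℂ} {ε : ℝ} {Y : Set ℂ} (h : Separated x₀ ε Y)
    (hx₀ : x₀ ∉ Y) {y y' : ℂ} (hy : y ∈ Y) (hy' : y' ∈ Y) (hyy : y ≠ y') {t : ℝ}
    (ht : t ∈ Set.Icc 0 1) : spiral x₀ ε (spiralLoop x₀ ε y t) / spiral x₀ ε y' ∉ cut := by
  have hε : 0 < ε ^ 2 := pow_pos h.1 2
  rcases ht.1.eq_or_lt with rfl | h0
  · rw [spiralLoop_zero, spiral_self, zero_div]; exact zero_notMem_cut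
  rcases ht.2.eq_or_lt with rfl | h1
  · rw [spiralLoop_one, spiral_self, zero_div]; exact zero_notMem_cut
  refine fun hc => h.2 y hy y' hy' hyy _ ?_ (cut_subset_sector hε hc)
  rw [spiral_spiralLoop_div (ne_of_mem_of_not_mem hy hx₀)]
  exact lune_mem_sector hε ⟨h0, h1⟩

/-- The loop misses `y` because the lune misses `1`. It misses any other puncture because that
puncture lies on its own cut. -/
theorem Separated.spiralLoop_notMem {x₀ : ℂ} {ε : ℝ} {Y : Set ℂ} (h : Separated x₀ ε Y)
    (hx₀ : x₀ ∉ Y) {y : ℂ} (hy : y ∈ Y) {t : ℝ} (ht : t ∈ Set.Icc 0 1) :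
    spiralLoop x₀ ε y t ∉ Y := by
  intro hmem
  have hne : ∀ z ∈ Y, z ≠ x₀ := fun z hz e => hx₀ (e ▸ hz)
  by_cases hyy : y = spiralLoop x₀ ε y t
  · have := spiral_spiralLoop_div (hne y hy) ε t
    rw [← hyy, div_self (spiral_ne_zero ε (hne y hy))] at this
    exact lune_ne_one (div_pos (pow_pos h.1 2) two_pos).ne' this.symm
  · have := h.spiralLoop_div_notMem_cut hx₀ hy hmem hyy ht
    rw [div_self (spiral_ne_zero ε (hne _ hmem))] at this
    exact this one_mem_cut

namespace Separated

variable {x₀ : ℂ} {ε : ℝ} {Y : Set ℂ} (h : Separated x₀ ε Y) (hx₀ : x₀ ∉ Y)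

/-- The spiral loop around `y ∈ Y` as a path in the complement of `Y`. -/
noncomputable def path (y : Y) : Path (⟨x₀, hx₀⟩ : (Yᶜ : Set ℂ)) ⟨x₀, hx₀⟩ where
  toFun t := ⟨spiralLoop x₀ ε y t, h.spiralLoop_notMem hx₀ y.2 t.2⟩
  continuous_toFun := by
    refine Continuous.subtype_mk ?_ _
    exact (continuous_spiralLoop x₀ y).comp (f := fun t : I => (ε, (t : ℝ))) (by fun_prop)
  source' := Subtype.ext (spiralLoop_zero x₀ ε y)
  target' := Subtype.ext (spiralLoop_one x₀ ε y)

end Separated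

/-! ### Simply connected pieces of the punctured plane -/

theorem isSimplyConnected_spiral_preimage (x₀ : ℂ) (ε : ℝ) {Y D : Set ℂ}
    (hD : ContractibleSpace D) (hDY : ∀ y ∈ Y, spiral x₀ ε y ∉ D) :
    IsSimplyConnected {z : (Yᶜ : Set ℂ) | spiral x₀ ε z ∈ D} := by
  rw [← Topology.IsEmbedding.subtypeVal.isSimplyConnected_image]
  have : Subtype.val '' {z : (Yᶜ : Set ℂ) | spiral x₀ ε z ∈ D} = spiral x₀ ε ⁻¹' D := by
    ext z
    constructor
    · rintro ⟨w, hw, rfl⟩; exact hw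
    · exact fun hz => ⟨⟨z, fun hzY => hDY z hzY hz⟩, hz, rfl⟩
  rw [this, Homeomorph.isSimplyConnected_preimage]
  exact SimplyConnectedSpace.ofContractible D

theorem isClosed_cut : IsClosed cut :=
  (isClosed_eq Complex.continuous_im continuous_const).inter
    (isClosed_le continuous_const Complex.continuous_re)

theorem isOpen_sector (η : ℝ) : IsOpen (sector η) :=
  isOpen_lt (by fun_prop) (by fun_prop)

theorem convex_sector {η : ℝ} : Convex ℝ (sector η) := by
  have : sector η = {u : ℂ | u.im < η * u.re} ∩ {u : ℂ | -(η * u.re) < u.im} := by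
    ext u
    change |u.im| < η * u.re ↔ _
    rw [abs_lt, and_comm]
    rfl
  rw [this]
  refine Convex.inter ?_ ?_
  · have := convex_halfSpace_lt (𝕜 := ℝ) (f := fun u : ℂ => u.im - η * u.re)
      ⟨fun x y => by simp; ring, fun c x => by simp; ring⟩ 0
    simpa only [sub_neg] using this
  · have := convex_halfSpace_lt (𝕜 := ℝ) (f := fun u : ℂ => -(η * u.re) - u.im)
      ⟨fun x y => by simp; ring, fun c x => by simp; ring⟩ 0
    simpa only [sub_neg] using this

theorem convex_setOf_div_mem {K : Set ℂ} (hK : Convex ℝ K) (c : ℂ) :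
    Convex ℝ {w : ℂ | w / c ∈ K} :=
  hK.is_linear_preimage ⟨fun x y => add_div x y c, fun r x => smul_div_assoc r x c⟩

/-- The part of the sector to the right of `1`. -/
def farSector (η : ℝ) : Set ℂ := sector η ∩ {u | 1 < u.re}

theorem convex_farSector (η : ℝ) : Convex ℝ (farSector η) :=
  convex_sector.inter (convex_halfSpace_re_gt 1)

theorem isOpen_farSector (η : ℝ) : IsOpen (farSector η) :=
  (isOpen_sector η).inter (isOpen_lt continuous_const Complex.continuous_re)

theorem one_notMem_farSector (η : ℝ) : (1 : ℂ) ∉ farSector η := fun h => lt_irrefl (1 : ℝ) h.2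

/-- The set `K` is general so that the far sector and its two halves are covered at once. No
puncture interferes: `y` has coordinate `1`, outside the far sector, and the others are excluded by
separation. -/
theorem Separated.isSimplyConnected_sector {x₀ : ℂ} {ε : ℝ} {Y K : Set ℂ}
    (h : Separated x₀ ε Y) (hx₀ : x₀ ∉ Y) (hK : Convex ℝ K) (hK' : K.Nonempty)
    (hKs : K ⊆ farSector (ε ^ 2)) {y : ℂ} (hy : y ∈ Y) :
    IsSimplyConnected {z : (Yᶜ : Set ℂ) | spiral x₀ ε z / spiral x₀ ε y ∈ K} := by
  have hne : ∀ z ∈ Y, spiral x₀ ε z ≠ 0 :=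
    fun z hz => spiral_ne_zero ε (ne_of_mem_of_not_mem hz hx₀)
  refine isSimplyConnected_spiral_preimage x₀ ε (D := {w | w / spiral x₀ ε y ∈ K}) ?_ ?_
  · refine (convex_setOf_div_mem hK _).contractibleSpace ?_
    obtain ⟨u, hu⟩ := hK'
    exact ⟨spiral x₀ ε y * u, by
      rwa [Set.mem_ofPred_eq, mul_div_cancel_left₀ _ (hne y hy)]⟩
  · intro z hz hzK
    by_cases hyz : y = z
    · subst hyz
      rw [Set.mem_ofPred_eq, div_self (hne y hy)] at hzK
      exact one_notMem_farSector _ (hKs hzK)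
    · refine h.2 y hy z hz hyz _ (hKs hzK).1 ?_
      rw [div_self (hne z hz)]
      exact cut_subset_sector (pow_pos h.1 2) one_mem_cut

/-- Each cut is invariant under scaling by factors at least `1`, so in spiral coordinates the
complement is star-shaped about `0`. -/
theorem isSimplyConnected_complement_cuts (x₀ : ℂ) (ε : ℝ) {Y : Set ℂ} (hx₀ : x₀ ∉ Y) :
    IsSimplyConnected
      {z : (Yᶜ : Set ℂ) | ∀ y : Y, spiral x₀ ε z / spiral x₀ ε y ∉ cut} := by
  refine isSimplyConnected_spiral_preimage x₀ ε
    (D := {w | ∀ y : Y, w / spiral x₀ ε y ∉ cut}) ?_ ?_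
  · have h0 : (0 : ℂ) ∈ {w | ∀ y : Y, w / spiral x₀ ε y ∉ cut} := by
      intro y
      rw [zero_div]
      exact zero_notMem_cut
    refine StarConvex.contractibleSpace (x := 0) ?_ ⟨0, h0⟩
    rw [starConvex_zero_iff]
    rintro w hw a ha ha' y ⟨him, hre⟩
    apply hw y
    rw [smul_div_assoc] at him hre
    rw [Complex.smul_re, smul_eq_mul] at hre
    rw [Complex.smul_im, smul_eq_mul] at him
    have ha0 : a ≠ 0 := by
      rintro rfl
      norm_num at hre
    refine ⟨(mul_eq_zero.1 him).resolve_left ha0, hre.trans ?_⟩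
    have : 0 < (w / spiral x₀ ε y).re := pos_of_mul_pos_right (one_pos.trans_le hre) ha
    nlinarith
  · intro y hy h
    refine h ⟨y, hy⟩ ?_
    rw [div_self (spiral_ne_zero ε (ne_of_mem_of_not_mem hy hx₀))]
    exact one_mem_cut

theorem isOpen_spiral_div_preimage (x₀ : ℂ) (ε : ℝ) {Y K : Set ℂ} (y : ℂ) (hK : IsOpen K) :
    IsOpen {z : (Yᶜ : Set ℂ) | spiral x₀ ε z / spiral x₀ ε y ∈ K} :=
  hK.preimage (((spiral x₀ ε).continuous.comp continuous_subtype_val).div_const _)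

/-! ### The cut decomposition of the punctured plane -/

namespace Separated

variable {x₀ : ℂ} {ε : ℝ} {Y : Set ℂ} (h : Separated x₀ ε Y) (hx₀ : x₀ ∉ Y) (hY : Y.Finite)

/-- The instant `1 / 4` in the unit interval. -/
noncomputable def quarter : I := ⟨1 / 4, by norm_num, by norm_num⟩

/-- The instant `3 / 4` in the unit interval. -/
noncomputable def threeQuarters : I := ⟨3 / 4, by norm_num, by norm_num⟩

theorem quarter_le : quarter ≤ threeQuarters := by
  change (1 / 4 : ℝ) ≤ 3 / 4
  norm_num

theorem path_div (y : Y) (t : I) : spiral x₀ ε (h.path hx₀ y t) / spiral x₀ ε y =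
    lune (ε ^ 2 / 2) t :=
  spiral_spiralLoop_div (ne_of_mem_of_not_mem y.2 hx₀) ε t

theorem path_div_notMem_cut (y : Y) (t : I) (ht : (t : ℝ) ≠ 1 / 2) (y' : Y) :
    spiral x₀ ε (h.path hx₀ y t) / spiral x₀ ε y' ∉ cut := by
  by_cases hyy : y = y'
  · subst hyy
    rw [path_div]
    exact lune_notMem_cut (div_pos (pow_pos h.1 2) two_pos).ne' ht
  · exact h.spiralLoop_div_notMem_cut hx₀ y.2 y'.2 (fun e => hyy (Subtype.ext e)) t.2

/-- Between these instants the real part is at least `3 / 2`. -/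
theorem lune_mem_farSector {η t : ℝ} (hη : 0 < η) (h₁ : 1 / 4 ≤ t) (h₂ : t ≤ 3 / 4) :
    lune (η / 2) t ∈ farSector η := by
  refine ⟨lune_mem_sector hη ⟨by linarith, by linarith⟩, ?_⟩
  change 1 < 8 * t * (1 - t)
  nlinarith

theorem lune_quarter_im {η : ℝ} (hη : 0 < η) : (lune (η / 2) (1 / 4)).im < 0 := by
  norm_num [lune]; linarith

theorem lune_threeQuarters_im {η : ℝ} (hη : 0 < η) : 0 < (lune (η / 2) (3 / 4)).im := by
  norm_num [lune]; linarith

theorem subpath_mem {X : Type*} [TopologicalSpace X] {a b : X} (p : Path a b) {s t : I}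
    (hst : s ≤ t) {S : Set X} (hS : ∀ r, s ≤ r → r ≤ t → p r ∈ S) (r : I) :
    p.subpath s t r ∈ S := by
  have : p.subpath s t r ∈ Set.range (p.subpath s t) := ⟨r, rfl⟩
  rw [Path.range_subpath_of_le _ _ _ hst] at this
  obtain ⟨r', hr', e⟩ := this
  rw [← e]
  exact hS r' hr'.1 hr'.2

theorem subpath_quarter_mem (y : Y) (t : I) :
    (h.path hx₀ y).subpath 0 quarter t ∈
      {z : (Yᶜ : Set ℂ) | ∀ y : Y, spiral x₀ ε z / spiral x₀ ε y ∉ cut} := by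
  refine subpath_mem _ unitInterval.nonneg' (fun r _ hr => ?_) t
  have hr : (r : ℝ) ≤ 1 / 4 := hr
  exact h.path_div_notMem_cut hx₀ y r fun e => by linarith

theorem subpath_threeQuarters_mem (y : Y) (t : I) :
    (h.path hx₀ y).subpath threeQuarters 1 t ∈
      {z : (Yᶜ : Set ℂ) | ∀ y : Y, spiral x₀ ε z / spiral x₀ ε y ∉ cut} := by
  refine subpath_mem _ unitInterval.le_one' (fun r hr _ => ?_) t
  have hr : (3 / 4 : ℝ) ≤ r := hr
  exact h.path_div_notMem_cut hx₀ y r fun e => by linarith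

/-- The cut decomposition of the complement of a finite set in spiral coordinates. -/
noncomputable def cutDecomposition : CutDecomposition (Yᶜ : Set ℂ) ⟨x₀, hx₀⟩ Y where
  U := {z | ∀ y : Y, spiral x₀ ε z / spiral x₀ ε y ∉ cut}
  V y := {z | spiral x₀ ε z / spiral x₀ ε y ∈ farSector (ε ^ 2)}
  L y := {z | spiral x₀ ε z / spiral x₀ ε y ∈ farSector (ε ^ 2) ∩ {u | u.im < 0}}
  R y := {z | spiral x₀ ε z / spiral x₀ ε y ∈ farSector (ε ^ 2) ∩ {u | 0 < u.im}}
  isOpen_U := by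
    have := hY.to_subtype
    rw [Set.ofPred_forall]
    exact isOpen_iInter_of_finite fun y =>
      isOpen_spiral_div_preimage x₀ ε y isClosed_cut.isOpen_compl
  isOpen_V y := isOpen_spiral_div_preimage x₀ ε y (isOpen_farSector _)
  isOpen_L y := isOpen_spiral_div_preimage x₀ ε y
    ((isOpen_farSector _).inter (isOpen_lt Complex.continuous_im continuous_const))
  isOpen_R y := isOpen_spiral_div_preimage x₀ ε y
    ((isOpen_farSector _).inter (isOpen_lt continuous_const Complex.continuous_im))
  -- A point of the cut of `y` outside the far sector has coordinate `1`, so it would be the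
  -- puncture `y` itself.
  cover z := by
    by_contra! hz
    obtain ⟨h1, h2⟩ := hz
    refine h1 fun y hy => h2 y ⟨cut_subset_sector (pow_pos h.1 2) hy, lt_of_le_of_ne hy.2 ?_⟩
    intro e
    have h3 : spiral x₀ ε z / spiral x₀ ε y = 1 := Complex.ext e.symm hy.1
    rw [div_eq_one_iff_eq (spiral_ne_zero ε (ne_of_mem_of_not_mem y.2 hx₀))] at h3
    exact z.2 ((spiral x₀ ε).injective h3 ▸ y.2)
  disjoint_V y y' hyy := Set.disjoint_left.2 fun z hz hz' =>
    h.2 y y.2 y' y'.2 (fun e => hyy (Subtype.ext e)) _ hz.1 hz'.1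
  inter_eq y := by
    ext z
    constructor
    · rintro ⟨hz, hz'⟩
      rcases lt_trichotomy (spiral x₀ ε z / spiral x₀ ε y).im 0 with hi | hi | hi
      · exact Or.inl ⟨hz', hi⟩
      · exact (hz y ⟨hi, hz'.2.le⟩).elim
      · exact Or.inr ⟨hz', hi⟩
    · intro hz
      have hz' : spiral x₀ ε z / spiral x₀ ε y ∈ farSector (ε ^ 2) ∧
          (spiral x₀ ε z / spiral x₀ ε y).im ≠ 0 := by
        rcases hz with hz | hz
        exacts [⟨hz.1, ne_of_lt hz.2⟩, ⟨hz.1, ne_of_gt hz.2⟩]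
      refine ⟨fun y' hy' => ?_, hz'.1⟩
      by_cases hyy : y = y'
      · subst hyy; exact hz'.2 hy'.1
      · exact h.2 y y.2 y' y'.2 (fun e => hyy (Subtype.ext e)) _ hz'.1.1
          (cut_subset_sector (pow_pos h.1 2) hy')
  disjoint_LR y := Set.disjoint_left.2 fun z hz hz' =>
    lt_asymm (show (spiral x₀ ε z / spiral x₀ ε y).im < 0 from hz.2) hz'.2
  isSimplyConnected_U := isSimplyConnected_complement_cuts x₀ ε hx₀
  isSimplyConnected_V y := h.isSimplyConnected_sector hx₀ (convex_farSector _)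
    ⟨_, lune_mem_farSector (t := 1 / 4) (pow_pos h.1 2) le_rfl (by norm_num)⟩ subset_rfl y.2
  isPathConnected_L y := (h.isSimplyConnected_sector hx₀
    ((convex_farSector _).inter (convex_halfSpace_im_lt 0))
    ⟨_, lune_mem_farSector (t := 1 / 4) (pow_pos h.1 2) le_rfl (by norm_num),
      lune_quarter_im (pow_pos h.1 2)⟩ Set.inter_subset_left y.2).isPathConnected
  isPathConnected_R y := (h.isSimplyConnected_sector hx₀
    ((convex_farSector _).inter (convex_halfSpace_im_gt 0))
    ⟨_, lune_mem_farSector (t := 3 / 4) (pow_pos h.1 2) (by norm_num) le_rfl,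
      lune_threeQuarters_im (pow_pos h.1 2)⟩ Set.inter_subset_left y.2).isPathConnected
  l y := h.path hx₀ y quarter
  r y := h.path hx₀ y threeQuarters
  l_mem y := by
    rw [Set.mem_ofPred_eq, path_div]
    exact ⟨lune_mem_farSector (pow_pos h.1 2) le_rfl quarter_le, lune_quarter_im (pow_pos h.1 2)⟩
  r_mem y := by
    rw [Set.mem_ofPred_eq, path_div]
    exact ⟨lune_mem_farSector (pow_pos h.1 2) quarter_le le_rfl,
      lune_threeQuarters_im (pow_pos h.1 2)⟩
  a y := ((h.path hx₀ y).subpath 0 quarter).cast (h.path hx₀ y).source.symm rfl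
  b y := (h.path hx₀ y).subpath quarter threeQuarters
  c y := ((h.path hx₀ y).subpath threeQuarters 1).cast rfl (h.path hx₀ y).target.symm
  a_mem := h.subpath_quarter_mem hx₀
  b_mem y := subpath_mem _ quarter_le fun r hr hr' => by
    rw [Set.mem_ofPred_eq, path_div]
    exact lune_mem_farSector (pow_pos h.1 2) hr hr'
  c_mem := h.subpath_threeQuarters_mem hx₀
  base_mem y := by
    rw [spiral_self, zero_div]
    exact zero_notMem_cut

theorem cutDecomposition_loop (y : Y) : (h.cutDecomposition hx₀ hY).loop y =
    FundamentalGroup.fromPath (.mk (h.path hx₀ y)) := by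
  change Path.Homotopic.Quotient.trans _ (Path.Homotopic.Quotient.trans _ _) =
    Path.Homotopic.Quotient.mk _
  rw [← Path.Homotopic.Quotient.trans_assoc]
  refine (congrArg (fun q => Path.Homotopic.Quotient.trans q _)
    (Path.Homotopic.Quotient.mk_subpath_trans (h.path hx₀ y) quarter threeQuarters rfl)).trans ?_
  refine (Path.Homotopic.Quotient.mk_subpath_trans (h.path hx₀ y) threeQuarters 1
    (h.path hx₀ y).target).trans ?_
  exact Path.Homotopic.Quotient.mk_subpath_zero_one _

/-- The homotopy moves the parameter linearly from `ε` to `ε'`. Separation is therefore needed on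
the whole interval. -/
theorem mk_path_eq {ε₀ ε' : ℝ} (hε₀ : ∀ ε ∈ Set.Ioo 0 ε₀, Separated x₀ ε Y)
    (hε : ε ∈ Set.Ioo 0 ε₀) (hε' : ε' ∈ Set.Ioo 0 ε₀) (y : Y) :
    Path.Homotopic.Quotient.mk ((hε₀ ε hε).path hx₀ y) = .mk ((hε₀ ε' hε').path hx₀ y) := by
  rw [Path.Homotopic.Quotient.eq]
  have hmem : ∀ s : I, (1 - (s : ℝ)) * ε + s * ε' ∈ Set.Ioo 0 ε₀ := fun s =>
    convex_Ioo 0 ε₀ hε hε' (by linarith [s.2.2]) s.2.1 (by ring)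
  refine ⟨{
    toFun := fun p => ⟨spiralLoop x₀ ((1 - (p.1 : ℝ)) * ε + p.1 * ε') y p.2,
      (hε₀ _ (hmem p.1)).spiralLoop_notMem hx₀ y.2 p.2.2⟩
    continuous_toFun := ?_
    map_zero_left := ?_
    map_one_left := ?_
    prop' := ?_ }⟩
  · refine Continuous.subtype_mk ?_ _
    exact (continuous_spiralLoop x₀ y).comp
      (f := fun p : I × I => ((1 - (p.1 : ℝ)) * ε + p.1 * ε', (p.2 : ℝ))) (by fun_prop)
  · intro t
    exact Subtype.ext (by simp [path])
  · intro t
    exact Subtype.ext (by simp [path])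
  · rintro s t (rfl | rfl)
    · exact Subtype.ext (by simp [path, spiralLoop_zero])
    · exact Subtype.ext (by simp [path, spiralLoop_one])

end Separated

/-! ### Compatibility of the isomorphisms -/

theorem lemma3p2 (X : Set ℂ) (x₀ : ℂ) (hx₀ : x₀ ∉ X) :
    ∃ α : ∀ Y : FiniteSubsets X, FreeGroup Y.1 ≃* PiOne hx₀ Y,
      ∀ (Y Y' : FiniteSubsets X) (h : Y ≤ Y'),
        (psi hx₀ h).comp (α Y').toMonoidHom = (α Y).toMonoidHom.comp (phi h) := by
  have hn : ∀ Y : FiniteSubsets X, x₀ ∉ Y.1 := fun Y h => hx₀ (Y.2.1 h)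
  choose ε₀ hpos hsep using fun Y : FiniteSubsets X => exists_forall_separated Y.2.2 (hn Y)
  have hhalf : ∀ Y, ε₀ Y / 2 ∈ Set.Ioo 0 (ε₀ Y) := fun Y =>
    ⟨half_pos (hpos Y), half_lt_self (hpos Y)⟩
  let α : ∀ Y : FiniteSubsets X, FreeGroup Y.1 ≃* PiOne hx₀ Y := fun Y =>
    ((hsep Y _ (hhalf Y)).cutDecomposition (hn Y) Y.2.2).freeGroupEquiv
  -- `α Y` is built with the parameter `ε₀ Y / 2`, but its values on generators can be computed with
  -- any admissible one.
  have hα : ∀ (Y : FiniteSubsets X) (ε : ℝ) (hε : ε ∈ Set.Ioo 0 (ε₀ Y)) (y : Y.1),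
      α Y (FreeGroup.of y) =
        FundamentalGroup.fromPath (.mk ((hsep Y ε hε).path (hn Y) y)) := by
    intro Y ε hε y
    refine (CutDecomposition.freeGroupEquiv_of _ y).trans
      ((Separated.cutDecomposition_loop _ _ _ y).trans ?_)
    exact Separated.mk_path_eq (hn Y) (hsep Y) (hhalf Y) hε y
  refine ⟨α, fun Y Y' h => FreeGroup.ext_hom _ _ fun y => ?_⟩
  obtain ⟨ε, hε⟩ : ∃ ε, ε ∈ Set.Ioo 0 (ε₀ Y) ∩ Set.Ioo 0 (ε₀ Y') := by
    have := lt_min (hpos Y) (hpos Y')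
    exact ⟨min (ε₀ Y) (ε₀ Y') / 2, ⟨half_pos this, (half_lt_self this).trans_le (min_le_left _ _)⟩,
      half_pos this, (half_lt_self this).trans_le (min_le_right _ _)⟩
  let p := ((hsep Y' ε hε.2).path (hn Y') y).map (complInclusion h).continuous
  have hl : psi hx₀ h (α Y' (FreeGroup.of y)) =
      FundamentalGroup.fromPath (Path.Homotopic.Quotient.mk p) := by
    rw [hα Y' ε hε.2]
    rfl
  change psi hx₀ h (α Y' (FreeGroup.of y)) = α Y (phi h (FreeGroup.of y))
  rw [hl, phi, FreeGroup.lift_apply_of]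
  split_ifs with hy
  -- With a common `ε`, both loops are given by the same formula.
  · rw [hα Y ε hε.1]
    rfl
  · rw [map_one]
    -- As `y ∉ Y`, the loop stays off every cut of `Y`, hence in a simply connected set containing
    -- the base point.
    refine (isSimplyConnected_complement_cuts x₀ ε (hn Y)).mk_eq p (Path.refl _) ?_ ?_
    · intro t y'
      exact (hsep Y' ε hε.2).spiralLoop_div_notMem_cut (hn Y') y.2 (h y'.2)
        (fun e => hy (e ▸ y'.2)) t.2
    · intro t y'
      change spiral x₀ ε x₀ / _ ∉ cut
      rw [spiral_self, zero_div]
      exact zero_notMem_cut
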